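/- Let $\mathbb D$ be the open unit disk and $\mathbb T$ the unit circle. For a holomorphic function $f$ on $\mathbb D$ write $f(z)=\sum_{n\ge 0} f_n z^n$. Let $H^2$ be the Hardy space of holomorphic $f$ on $\mathbb D$ with $\sum_n |f_n|^2<\infty$, with inner product $\langle f,g\rangle=\sum_n f_n\overline{g_n}$. A singular inner function is a function of the form $$\theta(z)=\exp\Big(-\int_{\mathbb T}\frac{\zeta+z}{\zeta-z}\,d\nu(\zeta)\Big),\qquad z\in\mathbb D,$$ where $\nu$ is a nonzero finite positive Borel measure on $\mathbb T$ that is singular with respect to Lebesgue measure (so $\theta$ is not constant). Its model space $K_\theta=H^2\ominus\theta H^2$ is the set of all $f\in H^2$ with $\langle f,\theta h\rangle=0$ for every $h\in H^2$. **Theorem.** Let $\lambda=\{\lambda_n\}_{n=0}^\infty$ be any increasing (not necessarily strictly) sequence of positive numbers with $\lim_{n\to\infty}\lambda_n=\infty$, and let $$H^2_\lambda=\Big\{f=\sum_{n=0}^\infty f_n z^n \text{ holomorphic on } \mathbb D:\ \sum_{n=0}^\infty \lambda_n|f_n|^2<\infty\Big\}.$$ Then there exists a singular inner function $\theta$ such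 that $$K_\theta\cap H^2_\lambda=\{0\}.$$ -/

import Mathlib

open scoped ComplexConjugate Nat

namespace HardyDisk

open MeasureTheory

/-- The open unit disk as a type. -/
abbrev Disk : Type := Complex.UnitDisc

/-- Extension of a function on the disk to `ℂ` by zero. -/
noncomputable def extendByZero (f : Disk → ℂ) : ℂ → ℂ :=
  Function.extend (fun z : Disk => (z : ℂ)) f 0

/-- `Hol(𝔻)`: the holomorphic functions on the unit disk. -/
def holomorphicFunctions : Set (Disk → ℂ) :=
  {f | DifferentiableOn ℂ (extendByZero f) (Metric.ball 0 1)}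

/-- The Taylor coefficient `f_n` in `f(z) = ∑ f_n z^n`. -/
noncomputable def taylorCoeff (f : Disk → ℂ) (n : ℕ) : ℂ :=
  iteratedDeriv n (extendByZero f) 0 / (n ! : ℂ)

/-- The Hardy space `H²` of holomorphic functions with square-summable Taylor coefficients. -/
def hardySpace : Set (Disk → ℂ) :=
  {f | f ∈ holomorphicFunctions ∧ Summable fun n => ‖taylorCoeff f n‖ ^ 2}

/-- The inner product of `H²`. -/
noncomputable def hardyInner (f g : Disk → ℂ) : ℂ :=
  ∑' n, taylorCoeff f n * conj (taylorCoeff g n)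

/-- `H²_λ`: holomorphic functions with `∑ λ_n |f_n|² < ∞`. -/
def weightedHardySpace (lam : ℕ → ℝ) : Set (Disk → ℂ) :=
  {f | f ∈ holomorphicFunctions ∧ Summable fun n => lam n * ‖taylorCoeff f n‖ ^ 2}

/-- `θH² = {θh : h ∈ H²}`. -/
def mulHardySpace (θ : Disk → ℂ) : Set (Disk → ℂ) :=
  {g | ∃ h ∈ hardySpace, g = θ * h}

/-- The model space `K_θ = H² ⊖ θH²`. -/
def modelSpace (θ : Disk → ℂ) : Set (Disk → ℂ) :=
  {f | f ∈ hardySpace ∧ ∀ g ∈ mulHardySpace θ, hardyInner f g = 0}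

/-- The Borel σ-algebra of the unit circle. -/
noncomputable instance : MeasurableSpace Circle := borel Circle

instance : BorelSpace Circle := ⟨rfl⟩

/-- Normalized Lebesgue (arc length) measure on the unit circle. -/
noncomputable def circleLebesgue : Measure Circle :=
  (ENNReal.ofReal (2 * Real.pi))⁻¹ •
    (volume.restrict (Set.Ioc (-Real.pi) Real.pi)).map (fun t : ℝ => Circle.exp t)

/-- The function `S_ν(z) = exp(-∫ (ζ + z)/(ζ - z) dν(ζ))` on the disk. -/
noncomputable def singularInner (ν : Measure Circle) (z : Disk) : ℂ :=
  Complex.exp (-∫ ζ : Circle, ((ζ : ℂ) + (z : ℂ)) / ((ζ : ℂ) - (z : ℂ)) ∂ν)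

/-- `θ = S_ν` for a nonzero finite positive Borel measure `ν` on the circle that is singular with
respect to Lebesgue measure; `ν ≠ 0` excludes the constant function `1`. -/
def IsSingularInner (θ : Disk → ℂ) : Prop :=
  ∃ ν : Measure Circle, IsFiniteMeasure ν ∧ ν ≠ 0 ∧ ν.MutuallySingular circleLebesgue ∧
    θ = singularInner ν

end HardyDisk

namespace HardyDisk

open MeasureTheory

/-! Write `θ = exp (-herglotz u)`, where the singular measure is the law of `exp (i u(t))` for a
uniform angle `t`. The map `u` is a uniform limit of maps `v_k` that subtract from `t` one of at
most `8 ^ k` constants. The law of `v_k` therefore has density at most `8 ^ k`, so `exp (herglotz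
v_k)` is bounded by `exp (8 ^ k)`, and `z ^ m * θ * exp (herglotz v_k)` is a bounded element of
`θH²`, very close to `z ^ m` on `|z| ≤ 1/2`.

For `f` in the intersection, orthogonality to this element expresses `f_m` as the pairing of `f`
with the error. Coordinates below `L_k` are small by Cauchy's estimates. The others are controlled
by the weight, as `lam (L_k)` dominates `exp (2 * 8 ^ k)` (`norm_le_of_inner_eq_zero`). There is no
circularity: `L_k` depends on `lam` alone, and the rate at which `v_k` approaches `u` is prescribed
afterwards (`exists_cantor_map`). Hence `f_m = O(1 / (k + 1))` for all large `k`, and `f = 0`.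

Singularity holds because the law of `u` lives on points whose `N_j`-th powers all stay near `1`, a
null set by Steinhaus' theorem. -/

/-! ### Taylor coefficients of bounded holomorphic functions -/

/-- Bessel's inequality for the Taylor coefficients of a bounded holomorphic function, on a circle
of radius `r < 1`. -/
theorem sum_sq_norm_taylor_mul_pow_le {F : ℂ → ℂ} {M r : ℝ}
    (hF : DifferentiableOn ℂ F (Metric.ball 0 1)) (hM : ∀ z ∈ Metric.ball (0 : ℂ) 1, ‖F z‖ ≤ M)
    (hr0 : 0 < r) (hr1 : r < 1) (s : Finset ℕ) :
    ∑ n ∈ s, (‖iteratedDeriv n F 0 / (n ! : ℂ)‖ * r ^ n) ^ 2 ≤ M ^ 2 := by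
  have hsub : Metric.closedBall (0 : ℂ) r ⊆ Metric.ball 0 1 := Metric.closedBall_subset_ball hr1
  have hF' : DiffContOnCl ℂ F (Metric.ball 0 r) :=
    (hF.mono (by rwa [closure_ball _ hr0.ne'])).diffContOnCl
  have hmem : ∀ t, circleMap 0 r t ∈ Metric.ball (0 : ℂ) 1 := fun t =>
    hsub (Metric.sphere_subset_closedBall (circleMap_mem_sphere 0 hr0.le t))
  have hcont : Continuous fun t : ℝ => F (circleMap 0 r t) :=
    hF.continuousOn.comp_continuous (continuous_circleMap 0 r) hmem
  have hL2 : MemLp (fun t : ℝ => F (circleMap 0 r t)) 2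
      (volume.restrict (Set.Ioc 0 (2 * Real.pi))) :=
    MemLp.of_bound hcont.aestronglyMeasurable M (Filter.Eventually.of_forall fun t => hM _ (hmem t))
  have hpi : (0 : ℝ) < 2 * Real.pi := Real.two_pi_pos
  have hsum := hasSum_sq_fourierCoeffOn hpi hL2
  -- By Cauchy's formula the `n`-th Fourier coefficient of `t ↦ F (r e^{it})` is the Taylor
  -- coefficient times `r ^ n`. Parseval then gives the bound once the remaining frequencies are
  -- discarded.
  have hcoef : ∀ n : ℕ, ‖fourierCoeffOn hpi (fun t : ℝ => F (circleMap 0 r t)) n‖ =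
      ‖iteratedDeriv n F 0 / (n ! : ℂ)‖ * r ^ n := by
    intro n
    have h1 := DiffContOnCl.circleIntegral_one_div_sub_center_pow_smul hr0 n hF'
    have h2 := Real.circleAverage_eq_circleIntegral (f := fun z => (z ^ n)⁻¹ * F z) (c := 0) hr0.ne'
    have h3 : iteratedDeriv n F 0 / (n ! : ℂ) =
        Real.circleAverage (fun z => (z ^ n)⁻¹ * F z) 0 r := by
      rw [h2]
      have : (∮ z in C(0, r), (z - 0)⁻¹ • ((z ^ n)⁻¹ * F z)) =
          ∮ z in C(0, r), (1 / (z - 0) ^ (n + 1)) • F z := by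
        congr 1
        ext z
        simp [pow_succ]
        ring
      rw [this, h1]
      have h4 : (2 * (Real.pi : ℂ) * Complex.I) ≠ 0 := by
        simp [Real.pi_ne_zero]
      simp only [smul_eq_mul]
      field_simp
    have h5 : fourierCoeffOn hpi (fun t : ℝ => F (circleMap 0 r t)) n =
        r ^ n * Real.circleAverage (fun z => (z ^ n)⁻¹ * F z) 0 r := by
      rw [fourierCoeffOn_eq_integral, Real.circleAverage_def]
      rw [mul_smul_comm, ← intervalIntegral.integral_const_mul]
      simp only [sub_zero, one_div]
      congr 1
      apply intervalIntegral.integral_congr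
      intro t _
      have hr : (r : ℂ) ≠ 0 := by exact_mod_cast hr0.ne'
      have hpi' : (Real.pi : ℂ) ≠ 0 := by exact_mod_cast Real.pi_ne_zero
      simp only [fourier_coe_apply, circleMap, zero_add, mul_pow, mul_inv, smul_eq_mul]
      rw [← Complex.exp_nat_mul, ← Complex.exp_neg]
      have : 2 * (Real.pi : ℂ) * Complex.I * ((-(n : ℤ) : ℤ) : ℂ) * (t : ℂ) /
          ((2 * Real.pi - 0 : ℝ) : ℂ) = -(n * (t * Complex.I)) := by
        push_cast
        rw [sub_zero]
        field_simp
      rw [this]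
      field_simp
    rw [h5, ← h3, norm_mul, mul_comm]
    simp [abs_of_pos hr0]
  have hbound : (2 * Real.pi - 0)⁻¹ • ∫ x in (0 : ℝ)..2 * Real.pi, ‖F (circleMap 0 r x)‖ ^ 2
      ≤ M ^ 2 := by
    have : ∫ x in (0 : ℝ)..2 * Real.pi, ‖F (circleMap 0 r x)‖ ^ 2 ≤
        ∫ x in (0 : ℝ)..2 * Real.pi, M ^ 2 := by
      apply intervalIntegral.integral_mono_on hpi.le
      · exact (hcont.norm.pow 2).intervalIntegrable _ _
      · simp
      · intro x _
        exact pow_le_pow_left₀ (norm_nonneg _) (hM _ (hmem x)) 2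
    rw [intervalIntegral.integral_const] at this
    simp only [sub_zero, smul_eq_mul] at this ⊢
    rw [inv_mul_le_iff₀ hpi]
    exact this
  calc ∑ n ∈ s, (‖iteratedDeriv n F 0 / (n ! : ℂ)‖ * r ^ n) ^ 2
      = ∑ i ∈ s.map ⟨((↑) : ℕ → ℤ), Nat.cast_injective⟩,
          ‖fourierCoeffOn hpi (fun t : ℝ => F (circleMap 0 r t)) i‖ ^ 2 := by
        simp only [Finset.sum_map, Function.Embedding.coeFn_mk, hcoef]
    _ ≤ _ := sum_le_hasSum _ (fun i _ => by positivity) hsum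
    _ ≤ M ^ 2 := hbound

theorem sum_sq_norm_taylor_le {F : ℂ → ℂ} {M : ℝ}
    (hF : DifferentiableOn ℂ F (Metric.ball 0 1)) (hM : ∀ z ∈ Metric.ball (0 : ℂ) 1, ‖F z‖ ≤ M)
    (s : Finset ℕ) :
    ∑ n ∈ s, ‖iteratedDeriv n F 0 / (n ! : ℂ)‖ ^ 2 ≤ M ^ 2 := by
  have h : Filter.Tendsto
      (fun r : ℝ => ∑ n ∈ s, (‖iteratedDeriv n F 0 / (n ! : ℂ)‖ * r ^ n) ^ 2)
      (nhdsWithin 1 (Set.Iio 1))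
      (nhds (∑ n ∈ s, (‖iteratedDeriv n F 0 / (n ! : ℂ)‖ * 1 ^ n) ^ 2)) :=
    ((by fun_prop : Continuous fun r : ℝ =>
      ∑ n ∈ s, (‖iteratedDeriv n F 0 / (n ! : ℂ)‖ * r ^ n) ^ 2).tendsto 1).mono_left
      nhdsWithin_le_nhds
  simp only [one_pow, mul_one] at h
  refine le_of_tendsto h ?_
  filter_upwards [Ioo_mem_nhdsLT (zero_lt_one : (0 : ℝ) < 1)] with r hr
  exact sum_sq_norm_taylor_mul_pow_le hF hM hr.1 hr.2 s

theorem summable_sq_norm_taylor {F : ℂ → ℂ} {M : ℝ}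
    (hF : DifferentiableOn ℂ F (Metric.ball 0 1)) (hM : ∀ z ∈ Metric.ball (0 : ℂ) 1, ‖F z‖ ≤ M) :
    Summable fun n => ‖iteratedDeriv n F 0 / (n ! : ℂ)‖ ^ 2 :=
  summable_of_sum_le (fun _ => by positivity) (sum_sq_norm_taylor_le hF hM)

theorem tsum_sq_norm_taylor_le {F : ℂ → ℂ} {M : ℝ}
    (hF : DifferentiableOn ℂ F (Metric.ball 0 1)) (hM : ∀ z ∈ Metric.ball (0 : ℂ) 1, ‖F z‖ ≤ M) :
    ∑' n, ‖iteratedDeriv n F 0 / (n ! : ℂ)‖ ^ 2 ≤ M ^ 2 :=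
  (summable_sq_norm_taylor hF hM).tsum_le_of_sum_le (sum_sq_norm_taylor_le hF hM)

/-- If `F` is within `ε` of `z ^ m` on the disk of radius `1 / 2`, then its Taylor coefficients are
close to those of `z ^ m`. -/
theorem norm_taylor_sub_le {F : ℂ → ℂ} {ε : ℝ} {m : ℕ}
    (hF : DifferentiableOn ℂ F (Metric.ball 0 1))
    (hε : ∀ z : ℂ, ‖z‖ ≤ 1 / 2 → ‖F z - z ^ m‖ ≤ ε) (n : ℕ) :
    ‖iteratedDeriv n F 0 / (n ! : ℂ) - if n = m then 1 else 0‖ ≤ 2 ^ n * ε := by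
  have hF' : DiffContOnCl ℂ (fun z => F z - z ^ m) (Metric.ball 0 (1 / 2)) := by
    refine ((hF.sub (by fun_prop)).mono ?_).diffContOnCl
    rw [closure_ball _ (by norm_num)]
    exact Metric.closedBall_subset_ball (by norm_num)
  -- Cauchy's estimate on the circle of radius `1 / 2` produces the factor `2 ^ n`.
  have h := Complex.norm_iteratedDeriv_le_of_forall_mem_sphere_norm_le (C := ε) n
    (by norm_num) hF' (fun z hz => hε z (by simpa using (mem_sphere_zero_iff_norm.1 hz).le))
  have hFa : ContDiffAt ℂ n F 0 :=
    (hF.analyticAt (Metric.ball_mem_nhds _ one_pos)).contDiffAt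
  have h2 : iteratedDeriv n (fun z => F z - z ^ m) 0 =
      iteratedDeriv n F 0 - if n = m then (n ! : ℂ) else 0 := by
    have := iteratedDeriv_sub (x := (0 : ℂ)) hFa (g := fun z : ℂ => z ^ m) (by fun_prop)
    rw [show (fun z => F z - z ^ m) = F - fun z : ℂ => z ^ m from rfl, this,
      iteratedDeriv_fun_pow_zero]
    by_cases hnm : n = m
    · simp [hnm]
    · simp [hnm]
  rw [h2] at h
  have hn : (0 : ℝ) < n ! := by positivity
  have h3 : iteratedDeriv n F 0 / (n ! : ℂ) - (if n = m then 1 else 0) =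
      (iteratedDeriv n F 0 - if n = m then (n ! : ℂ) else 0) / (n ! : ℂ) := by
    have : (n ! : ℂ) ≠ 0 := by exact_mod_cast n.factorial_ne_zero
    split_ifs <;> simp [sub_div, this]
  rw [h3, norm_div, Complex.norm_natCast, div_le_iff₀ hn]
  refine h.trans (le_of_eq ?_)
  rw [one_div, inv_pow, div_inv_eq_mul]
  ring

/-! ### Functions on the disk and their coefficients -/

theorem extendByZero_apply (f : Disk → ℂ) (z : Disk) : extendByZero f z = f z :=
  Complex.UnitDisc.coe_injective.extend_apply f 0 z

/-- Every point of the open unit ball is the coordinate of a point of the disk. -/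
theorem exists_disk_eq {z : ℂ} (hz : z ∈ Metric.ball (0 : ℂ) 1) : ∃ w : Disk, (w : ℂ) = z :=
  ⟨⟨z, hz⟩, rfl⟩

theorem extendByZero_eqOn {f : Disk → ℂ} {F : ℂ → ℂ} (h : ∀ z : Disk, f z = F z) :
    Set.EqOn (extendByZero f) F (Metric.ball 0 1) := by
  intro z hz
  obtain ⟨w, rfl⟩ := exists_disk_eq hz
  rw [extendByZero_apply, h]

theorem mem_holomorphicFunctions {f : Disk → ℂ} {F : ℂ → ℂ} (h : ∀ z : Disk, f z = F z)
    (hF : DifferentiableOn ℂ F (Metric.ball 0 1)) : f ∈ holomorphicFunctions :=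
  hF.congr (extendByZero_eqOn h)

theorem taylorCoeff_eq {f : Disk → ℂ} {F : ℂ → ℂ} (h : ∀ z : Disk, f z = F z) (n : ℕ) :
    taylorCoeff f n = iteratedDeriv n F 0 / (n ! : ℂ) := by
  have : extendByZero f =ᶠ[nhds 0] F :=
    Filter.eventuallyEq_of_mem (Metric.ball_mem_nhds _ one_pos) (extendByZero_eqOn h)
  rw [taylorCoeff, this.iteratedDeriv_eq n]

theorem mem_hardySpace_of_bounded {f : Disk → ℂ} {F : ℂ → ℂ} {M : ℝ} (h : ∀ z : Disk, f z = F z)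
    (hF : DifferentiableOn ℂ F (Metric.ball 0 1)) (hM : ∀ z ∈ Metric.ball (0 : ℂ) 1, ‖F z‖ ≤ M) :
    f ∈ hardySpace := by
  refine ⟨mem_holomorphicFunctions h hF, ?_⟩
  simp_rw [taylorCoeff_eq h]
  exact summable_sq_norm_taylor hF hM

theorem eq_zero_of_taylorCoeff_eq_zero {f : Disk → ℂ} (hf : f ∈ holomorphicFunctions)
    (h : ∀ n, taylorCoeff f n = 0) : f = 0 := by
  ext z
  have hz : (z : ℂ) ∈ Metric.ball (0 : ℂ) 1 := mem_ball_zero_iff.2 z.norm_lt_one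
  have h1 := Complex.taylorSeries_eq_on_ball' hz hf
  have h2 : ∀ n, (n ! : ℂ)⁻¹ * iteratedDeriv n (extendByZero f) 0 = 0 := fun n => by
    rw [mul_comm, ← div_eq_mul_inv]
    exact h n
  simp only [h2, zero_mul, tsum_zero] at h1
  rw [← extendByZero_apply f z, ← h1]
  rfl

theorem taylorCoeff_zero (n : ℕ) : taylorCoeff 0 n = 0 := by
  rw [taylorCoeff_eq (f := 0) (F := fun _ => 0) (fun _ => rfl)]
  simp

theorem zero_mem_holomorphicFunctions : (0 : Disk → ℂ) ∈ holomorphicFunctions :=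
  mem_holomorphicFunctions (F := fun _ => 0) (fun _ => rfl) (by fun_prop)

theorem zero_mem_modelSpace (θ : Disk → ℂ) : (0 : Disk → ℂ) ∈ modelSpace θ :=
  ⟨⟨zero_mem_holomorphicFunctions, by simp [taylorCoeff_zero]⟩,
    fun g _ => by simp [hardyInner, taylorCoeff_zero]⟩

theorem zero_mem_weightedHardySpace (lam : ℕ → ℝ) : (0 : Disk → ℂ) ∈ weightedHardySpace lam :=
  ⟨zero_mem_holomorphicFunctions, by simp [taylorCoeff_zero]⟩

/-! ### The duality estimate -/

/-- Quantitative duality: if `b` is orthogonal to `a`, is close to the `m`-th unit vector in the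
first `L` coordinates and is controlled in `ℓ²`, then `a m` is small. -/
theorem norm_le_of_inner_eq_zero {lam : ℕ → ℝ} (hpos : ∀ n, 0 < lam n) (hmono : Monotone lam)
    {a b : ℕ → ℂ} (hsa : Summable fun n => lam n * ‖a n‖ ^ 2)
    (hsb : Summable fun n => ‖b n‖ ^ 2) {G B ε δ : ℝ} {L m : ℕ} (hm : m < L)
    (hG : ∑' n, ‖b n‖ ^ 2 ≤ G ^ 2) (hab : ∑' n, a n * conj (b n) = 0) (hB : ∀ n, ‖a n‖ ≤ B)
    (hε : ∀ n < L, ‖b n - if n = m then 1 else 0‖ ≤ ε) (hδ : 0 < δ)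
    (hL : G ^ 2 ≤ δ ^ 2 * lam L) :
    ‖a m‖ ≤ L * (B * ε) + δ / 2 * ∑' n, lam n * ‖a n‖ ^ 2 + δ / 2 := by
  have hlL := hpos L
  have hB0 : 0 ≤ B := (norm_nonneg _).trans (hB 0)
  set e : ℕ → ℂ := fun n => if n = m then 1 else 0 with he
  set d : ℕ → ℝ := fun n => if n < L then B * ε else 0 with hd
  have hds : HasSum d (L * (B * ε)) := by
    have : HasSum d (∑ n ∈ Finset.range L, d n) :=
      hasSum_sum_of_ne_finset_zero (fun n hn => by simp_all)
    rwa [Finset.sum_congr rfl (g := fun _ => B * ε) (fun n hn => by simp_all), Finset.sum_const,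
      Finset.card_range, nsmul_eq_mul] at this
  have hpt : ∀ n, ‖a n * conj (e n - b n)‖ ≤
      d n + δ / 2 * (lam n * ‖a n‖ ^ 2) + (2 * δ * lam L)⁻¹ * ‖b n‖ ^ 2 := by
    intro n
    rw [norm_mul, RCLike.norm_conj]
    have hln := hpos n
    by_cases hn : n < L
    · have h1 := hε n hn
      rw [norm_sub_rev] at h1
      have : ‖a n‖ * ‖e n - b n‖ ≤ B * ε := mul_le_mul (hB n) h1 (norm_nonneg _) hB0
      simp only [hd, hn, if_true]
      have : 0 ≤ δ / 2 * (lam n * ‖a n‖ ^ 2) + (2 * δ * lam L)⁻¹ * ‖b n‖ ^ 2 := by positivity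
      linarith
    · have h0 : e n = 0 := by simp [he]; omega
      simp only [hd, hn, if_false, h0, zero_sub, norm_neg, zero_add]
      have h2 : δ / 2 * (lam L * ‖a n‖ ^ 2) ≤ δ / 2 * (lam n * ‖a n‖ ^ 2) := by
        have := hmono (not_lt.1 hn)
        gcongr
      refine le_trans ?_ (add_le_add_left h2 _)
      -- AM-GM by completing the square. The weights are balanced so that, after summation, `hL`
      -- bounds the `‖b n‖ ^ 2` part by `δ / 2`.
      have h3 : δ / 2 * (lam L * ‖a n‖ ^ 2) + (2 * δ * lam L)⁻¹ * ‖b n‖ ^ 2 - ‖a n‖ * ‖b n‖ =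
          (2 * δ * lam L)⁻¹ * (δ * lam L * ‖a n‖ - ‖b n‖) ^ 2 := by
        field_simp
        ring
      have : 0 ≤ (2 * δ * lam L)⁻¹ * (δ * lam L * ‖a n‖ - ‖b n‖) ^ 2 := by positivity
      linarith
  have hmaj := (hds.add (hsa.hasSum.mul_left (δ / 2))).add (hsb.hasSum.mul_left (2 * δ * lam L)⁻¹)
  have hs : Summable fun n => ‖a n * conj (e n - b n)‖ :=
    Summable.of_nonneg_of_le (fun _ => norm_nonneg _) hpt hmaj.summable
  have hse : HasSum (fun n => a n * conj (e n)) (a m) := by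
    have := hasSum_single (f := fun n => a n * conj (e n)) m
      (fun n hn => by simp [he, hn])
    simpa [he] using this
  have hsab : Summable fun n => a n * conj (b n) := by
    have := hse.summable.sub hs.of_norm
    refine this.congr fun n => ?_
    simp only [map_sub]
    ring
  have hkey : ∑' n, a n * conj (e n - b n) = a m := by
    have := (hse.sub hsab.hasSum).tsum_eq
    rw [hab, sub_zero] at this
    rw [← this]
    congr 1
    ext n
    simp only [map_sub]
    ring
  rw [← hkey]
  refine (norm_tsum_le_tsum_norm hs).trans ((hs.tsum_le_tsum hpt hmaj.summable).trans ?_)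
  rw [hmaj.tsum_eq]
  have : (2 * δ * lam L)⁻¹ * ∑' n, ‖b n‖ ^ 2 ≤ δ / 2 := by
    rw [inv_mul_le_iff₀ (by positivity)]
    calc _ ≤ G ^ 2 := hG
      _ ≤ _ := hL
      _ = _ := by ring
  linarith

/-! ### The Cantor-type map -/

/-- Moves `t` to the left so that `N * t` falls into the first eighth of its period. -/
noncomputable def squeeze (N : ℕ) (t : ℝ) : ℝ :=
  t - 2 * Real.pi / (8 * N) * ((⌊8 * N * t / (2 * Real.pi)⌋ % 8 : ℤ) : ℝ)

theorem measurable_squeeze (N : ℕ) : Measurable (squeeze N) := by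
  have h : Measurable fun t : ℝ => ⌊8 * N * t / (2 * Real.pi)⌋ :=
    Int.measurable_floor.comp (by fun_prop)
  have h' : Measurable fun i : ℤ => ((i % 8 : ℤ) : ℝ) := measurable_from_top
  exact measurable_id.sub ((h'.comp h).const_mul _)

theorem squeeze_mem_shifts (N : ℕ) (t : ℝ) :
    ∃ i ∈ Finset.range 8, squeeze N t = t - 2 * Real.pi / (8 * N) * (i : ℝ) := by
  have h0 := Int.emod_nonneg ⌊8 * N * t / (2 * Real.pi)⌋ (by norm_num : (8 : ℤ) ≠ 0)
  have h1 := Int.emod_lt_of_pos ⌊8 * N * t / (2 * Real.pi)⌋ (by norm_num : (0 : ℤ) < 8)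
  obtain ⟨i, hi⟩ := Int.eq_ofNat_of_zero_le h0
  refine ⟨i, Finset.mem_range.2 (by omega), ?_⟩
  rw [squeeze, hi]
  simp

theorem abs_squeeze_sub_le {N : ℕ} (t : ℝ) :
    |squeeze N t - t| ≤ 2 * Real.pi / N := by
  obtain ⟨i, hi, h⟩ := squeeze_mem_shifts N t
  have hi' : (i : ℝ) ≤ 8 := by exact_mod_cast (Finset.mem_range.1 hi).le
  have hp := Real.pi_pos
  rw [h, sub_sub_cancel_left, abs_neg, abs_of_nonneg (by positivity)]
  calc 2 * Real.pi / (8 * N) * (i : ℝ) ≤ 2 * Real.pi / (8 * N) * 8 := by gcongr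
    _ = 2 * Real.pi / N := by field_simp

/-- Modulo `2π`, `N * squeeze N t` lies in `[0, π/4)`, and `π/4 < 4/5`. The gap below `1` is left
for the later squeezes. -/
theorem norm_exp_squeeze_sub_one_le {N : ℕ} (hN : 0 < N) (t : ℝ) :
    ‖Complex.exp (Complex.I * ((N * squeeze N t : ℝ) : ℂ)) - 1‖ ≤ 4 / 5 := by
  set y : ℝ := 8 * N * t / (2 * Real.pi) with hy
  have hp := Real.pi_pos
  have hN' : (0 : ℝ) < N := by exact_mod_cast hN
  have hfl : (⌊y⌋ : ℝ) = 8 * ((⌊y⌋ / 8 : ℤ) : ℝ) + ((⌊y⌋ % 8 : ℤ) : ℝ) := by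
    exact_mod_cast (Int.mul_ediv_add_emod ⌊y⌋ 8).symm
  have h1 : N * squeeze N t =
      2 * Real.pi / 8 * Int.fract y + ((⌊y⌋ / 8 : ℤ) : ℝ) * (2 * Real.pi) := by
    have h2 : N * t = 2 * Real.pi / 8 * y := by rw [hy]; field_simp
    have h3 : N * (2 * Real.pi / (8 * N)) = 2 * Real.pi / 8 := by field_simp
    rw [squeeze, ← hy, mul_sub, ← mul_assoc, h2, h3, Int.fract, hfl]
    ring
  have h4 : Complex.exp (Complex.I * ((N * squeeze N t : ℝ) : ℂ)) =
      Complex.exp (Complex.I * ((2 * Real.pi / 8 * Int.fract y : ℝ) : ℂ)) := by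
    rw [h1]
    push_cast
    rw [mul_add, Complex.exp_add]
    have : Complex.exp (Complex.I * (((⌊y⌋ / 8 : ℤ) : ℂ) * (2 * Real.pi))) = 1 := by
      rw [Complex.exp_eq_one_iff]
      exact ⟨⌊y⌋ / 8, by ring⟩
    rw [this, mul_one]
  rw [h4]
  refine (Real.norm_exp_I_mul_ofReal_sub_one_le).trans ?_
  rw [Real.norm_eq_abs, abs_of_nonneg (mul_nonneg (by positivity) (Int.fract_nonneg y))]
  have := Int.fract_lt_one y
  have := Int.fract_nonneg y
  have := Real.pi_lt_d2
  nlinarith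

/-- Iterated squeezing along a sequence of frequencies. -/
noncomputable def squeezeIter (N : ℕ → ℕ) : ℕ → ℝ → ℝ
  | 0 => id
  | k + 1 => squeeze (N k) ∘ squeezeIter N k

theorem measurable_squeezeIter (N : ℕ → ℕ) (k : ℕ) : Measurable (squeezeIter N k) := by
  induction k with
  | zero => exact measurable_id
  | succ k ih => exact (measurable_squeeze _).comp ih

/-- Each squeeze subtracts one of eight constants that do not depend on `t`, so the number of
possible total shifts grows at most eightfold per stage. -/
theorem squeezeIter_shifts (N : ℕ → ℕ) (k : ℕ) :
    ∃ F : Finset ℝ, F.card ≤ 8 ^ k ∧ ∀ t, ∃ s ∈ F, squeezeIter N k t = t - s := by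
  classical
  induction k with
  | zero => exact ⟨{0}, by simp, fun t => ⟨0, by simp, by simp [squeezeIter]⟩⟩
  | succ k ih =>
    obtain ⟨F, hF, h⟩ := ih
    refine ⟨Finset.image₂ (fun s (i : ℕ) => s + 2 * Real.pi / (8 * N k) * (i : ℝ)) F
      (Finset.range 8), ?_, fun t => ?_⟩
    · refine (Finset.card_image₂_le _ _ _).trans ?_
      rw [Finset.card_range, pow_succ]
      gcongr
    · obtain ⟨s, hs, hst⟩ := h t
      obtain ⟨i, hi, hit⟩ := squeeze_mem_shifts (N k) (squeezeIter N k t)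
      refine ⟨_, Finset.mem_image₂_of_mem hs hi, ?_⟩
      simp only [squeezeIter, Function.comp_apply, hit]
      rw [hst]
      ring

theorem exists_rapid_sequence (R : ℕ → ℕ) :
    ∃ N : ℕ → ℕ, (∀ k, 0 < N k) ∧ (∀ k, 64 * N k ≤ N (k + 1)) ∧ ∀ k, R k ≤ N k := by
  let N : ℕ → ℕ := fun k => Nat.rec (R 0 + 1) (fun j x => 64 * x + R (j + 1)) k
  have hs : ∀ k, N (k + 1) = 64 * N k + R (k + 1) := fun _ => rfl
  have h0 : N 0 = R 0 + 1 := rfl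
  refine ⟨N, fun k => ?_, fun k => ?_, fun k => ?_⟩
  · induction k with
    | zero => omega
    | succ k ih => rw [hs]; omega
  · rw [hs]; omega
  · cases k with
    | zero => omega
    | succ k => rw [hs]; omega

/-- Displacements from stage `k` on are dominated by a geometric series of ratio `1/64` and first
term `2π / N k`; its sum is below `7 / N k`. -/
theorem exists_squeezeIter_limit {N : ℕ → ℕ} (hN : ∀ k, 0 < N k)
    (hN' : ∀ k, 64 * N k ≤ N (k + 1)) :
    ∃ u : ℝ → ℝ, Measurable u ∧ ∀ k t, |u t - squeezeIter N k t| ≤ 7 / N k := by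
  have hp := Real.pi_pos
  have hpos : ∀ k, (0 : ℝ) < N k := fun k => by exact_mod_cast hN k
  have hgrow : ∀ k j, (N k : ℝ) * 64 ^ j ≤ N (k + j) := by
    intro k j
    induction j with
    | zero => simp
    | succ j ih =>
      have h1 : (64 : ℝ) * N (k + j) ≤ N (k + j + 1) := by exact_mod_cast hN' (k + j)
      rw [pow_succ, ← add_assoc]
      linarith
  have hd : ∀ k t j, dist (squeezeIter N (k + j) t) (squeezeIter N (k + (j + 1)) t) ≤
      2 * Real.pi / N k * (1 / 64) ^ j := by
    intro k t j
    rw [dist_comm, Real.dist_eq]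
    refine (abs_squeeze_sub_le (N := N (k + j)) _).trans ?_
    have h1 := hpos k
    rw [one_div, inv_pow, ← div_eq_mul_inv, div_div]
    exact div_le_div_of_nonneg_left (by positivity) (by positivity) (hgrow k j)
  have hc : ∀ t, ∃ x, Filter.Tendsto (fun j => squeezeIter N j t) Filter.atTop (nhds x) := fun t =>
    cauchySeq_tendsto_of_complete (cauchySeq_of_le_geometric (1 / 64) (2 * Real.pi / N 0)
      (by norm_num) fun j => by simpa using hd 0 t j)
  choose u hu using hc
  refine ⟨u, measurable_of_tendsto_metrizable (measurable_squeezeIter N) (tendsto_pi_nhds.2 hu),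
    fun k t => ?_⟩
  have ht : Filter.Tendsto (fun j => squeezeIter N (k + j) t) Filter.atTop (nhds (u t)) := by
    simpa [add_comm] using (Filter.tendsto_add_atTop_iff_nat k).2 (hu t)
  have h2 := dist_le_of_le_geometric_of_tendsto₀ (1 / 64) (2 * Real.pi / N k) (by norm_num)
    (hd k t) ht
  rw [dist_comm, Real.dist_eq] at h2
  refine h2.trans ?_
  have := Real.pi_lt_d2
  rw [div_right_comm]
  refine div_le_div_of_nonneg_right ?_ (hpos k).le
  rw [div_le_iff₀ (by norm_num)]
  linarith

/-- A Cantor-type map: all `u t` concentrate near the `N j`-th roots of unity for every `j`, while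
`u` is approximated at a prescribed rate by maps that are piecewise translations. -/
theorem exists_cantor_map {ρ : ℕ → ℝ} (hρ : ∀ k, 0 < ρ k) :
    ∃ (N : ℕ → ℕ) (u : ℝ → ℝ), Filter.Tendsto N Filter.atTop Filter.atTop ∧ (∀ j, 0 < N j) ∧
      Measurable u ∧ (∀ j t, ‖Complex.exp (Complex.I * ((N j * u t : ℝ) : ℂ)) - 1‖ < 1) ∧
      ∀ k, ∃ v : ℝ → ℝ, Measurable v ∧ (∀ t, |u t - v t| ≤ ρ k) ∧
        ∃ F : Finset ℝ, F.card ≤ 8 ^ k ∧ ∀ t, ∃ s ∈ F, v t = t - s := by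
  obtain ⟨N, hN, hN', hR⟩ := exists_rapid_sequence fun k => ⌈7 / ρ k⌉₊
  have hpos : ∀ k, (0 : ℝ) < N k := fun k => by exact_mod_cast hN k
  obtain ⟨u, hu, happ⟩ := exists_squeezeIter_limit hN hN'
  refine ⟨N, u, (strictMono_nat_of_lt_succ fun k => ?_).tendsto_atTop, hN, hu, fun j t => ?_,
    fun k => ⟨squeezeIter N k, measurable_squeezeIter N k, fun t => (happ k t).trans ?_,
      squeezeIter_shifts N k⟩⟩
  · have := hN k
    have := hN' k
    omega
  · have h1 := norm_exp_squeeze_sub_one_le (hN j) (squeezeIter N j t)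
    set x := squeeze (N j) (squeezeIter N j t) with hx
    -- Stage `j + 1` is the one just after squeezing at frequency `N j`. All later squeezes together
    -- change `N j * u t` by at most `7/64`, and `4/5 + 7/64 < 1`.
    have h2 : |u t - x| ≤ 7 / N (j + 1) := happ (j + 1) t
    have h3 : N j * |u t - x| ≤ 7 / 64 := by
      have h64 : (64 : ℝ) * N j ≤ N (j + 1) := by exact_mod_cast hN' j
      have h4 := hpos j
      calc N j * |u t - x| ≤ N j * (7 / (64 * N j)) := by
            gcongr
            exact h2.trans (div_le_div_of_nonneg_left (by norm_num) (by positivity) h64)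
        _ = 7 / 64 := by field_simp
    have h4 : ‖Complex.exp (Complex.I * ((N j * (u t - x) : ℝ) : ℂ)) - 1‖ ≤ 7 / 64 := by
      refine Real.norm_exp_I_mul_ofReal_sub_one_le.trans ?_
      rwa [Real.norm_eq_abs, abs_mul, abs_of_pos (hpos j)]
    have h5 : Complex.exp (Complex.I * ((N j * u t : ℝ) : ℂ)) - 1 =
        Complex.exp (Complex.I * ((N j * x : ℝ) : ℂ)) *
          (Complex.exp (Complex.I * ((N j * (u t - x) : ℝ) : ℂ)) - 1) +
        (Complex.exp (Complex.I * ((N j * x : ℝ) : ℂ)) - 1) := by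
      rw [mul_sub, ← Complex.exp_add]
      push_cast
      ring_nf
    rw [h5]
    refine (norm_add_le _ _).trans_lt ?_
    rw [norm_mul, mul_comm Complex.I, Complex.norm_exp_ofReal_mul_I, one_mul,
      mul_comm _ Complex.I]
    linarith
  · have h1 : 7 / ρ k ≤ N k := (Nat.le_ceil _).trans (by exact_mod_cast hR k)
    have h2 := hpos k
    rw [div_le_iff₀ (hρ k)] at h1
    rw [div_le_iff₀ h2]
    linarith

/-! ### The carrier is Lebesgue-null -/

/-- Points of the circle whose `N j`-th powers all stay within distance `1` of `1`. -/
def nearRoots (N : ℕ → ℕ) : Set Circle :=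
  {ζ | ∀ j, ‖((ζ ^ N j : Circle) : ℂ) - 1‖ < 1}

theorem measurableSet_nearRoots (N : ℕ → ℕ) : MeasurableSet (nearRoots N) := by
  rw [nearRoots, Set.ofPred_forall]
  refine MeasurableSet.iInter fun j => IsOpen.measurableSet ?_
  exact isOpen_lt (by fun_prop) continuous_const

theorem coe_exp_pow (N : ℕ) (t : ℝ) :
    ((Circle.exp t ^ N : Circle) : ℂ) = Complex.exp (Complex.I * ((N * t : ℝ) : ℂ)) := by
  rw [Circle.coe_pow, Circle.coe_exp, ← Complex.exp_nat_mul]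
  push_cast
  ring_nf

/-- If `A` had positive measure, `A - A` would contain a neighbourhood of `0` (Steinhaus), hence
some `π / N j`. Two points of `A` at this distance have opposite `N j`-th powers, which cannot both
be within `1` of `1`. -/
theorem volume_preimage_nearRoots {N : ℕ → ℕ} (hN : Filter.Tendsto N Filter.atTop Filter.atTop)
    (hpos : ∀ j, 0 < N j) : volume ((fun t : ℝ => Circle.exp t) ⁻¹' nearRoots N) = 0 := by
  set A := (fun t : ℝ => Circle.exp t) ⁻¹' nearRoots N with hA
  have hAm : MeasurableSet A :=
    (measurableSet_nearRoots N).preimage Circle.exp.continuous.measurable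
  by_contra h0
  have hnhds := Measure.sub_mem_nhds_zero_of_addHaar_pos volume A hAm (pos_iff_ne_zero.2 h0)
  have hlim : Filter.Tendsto (fun j => Real.pi / (N j : ℝ)) Filter.atTop (nhds 0) :=
    tendsto_const_nhds.div_atTop (tendsto_natCast_atTop_atTop.comp hN)
  obtain ⟨j, hj⟩ := (hlim.eventually_mem hnhds).exists
  obtain ⟨a, ha, b, hb, hab⟩ := Set.mem_sub.1 hj
  have h1 := ha j
  have h2 := hb j
  rw [coe_exp_pow] at h1 h2
  have hN' : (N j : ℝ) ≠ 0 := by exact_mod_cast (hpos j).ne'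
  have h3 : (N j : ℝ) * a = N j * b + Real.pi := by
    have : a = b + Real.pi / N j := by linarith
    rw [this]
    field_simp
  have h4 : Complex.exp (Complex.I * ((N j * a : ℝ) : ℂ)) =
      -Complex.exp (Complex.I * ((N j * b : ℝ) : ℂ)) := by
    rw [h3, Complex.ofReal_add, mul_add, Complex.exp_add, mul_comm Complex.I (Real.pi : ℂ),
      Complex.exp_pi_mul_I]
    ring
  rw [h4] at h1
  set w := Complex.exp (Complex.I * ((N j * b : ℝ) : ℂ))
  have h5 : ‖(-2 : ℂ)‖ ≤ ‖-w - 1‖ + ‖w - 1‖ := by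
    refine le_trans (le_of_eq ?_) (norm_add_le _ _)
    congr 1
    ring
  norm_num at h5
  linarith

/-! ### Herglotz transforms of angle laws -/

/-- Normalized Lebesgue measure on `(-π, π]`. -/
noncomputable def angleMeasure : Measure ℝ :=
  (ENNReal.ofReal (2 * Real.pi))⁻¹ • volume.restrict (Set.Ioc (-Real.pi) Real.pi)

instance : IsProbabilityMeasure angleMeasure := by
  refine ⟨?_⟩
  have h : ENNReal.ofReal (2 * Real.pi) ≠ 0 := by simp [Real.pi_pos]
  rw [angleMeasure, Measure.smul_apply, Measure.restrict_apply_univ, Real.volume_Ioc, smul_eq_mul,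
    sub_neg_eq_add, ← two_mul]
  exact ENNReal.inv_mul_cancel h ENNReal.ofReal_ne_top

theorem circleLebesgue_nearRoots {N : ℕ → ℕ} (hN : Filter.Tendsto N Filter.atTop Filter.atTop)
    (hpos : ∀ j, 0 < N j) : circleLebesgue (nearRoots N) = 0 := by
  rw [circleLebesgue, Measure.smul_apply, Measure.map_apply Circle.exp.continuous.measurable
    (measurableSet_nearRoots N)]
  have : (volume.restrict (Set.Ioc (-Real.pi) Real.pi))
      ((fun t : ℝ => Circle.exp t) ⁻¹' nearRoots N) = 0 :=
    Measure.absolutelyContinuous_of_le Measure.restrict_le_self (volume_preimage_nearRoots hN hpos)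
  rw [this, smul_zero]

theorem integral_angleMeasure (f : ℝ → ℝ) :
    ∫ t, f t ∂angleMeasure = (2 * Real.pi)⁻¹ * ∫ t in (-Real.pi)..Real.pi, f t := by
  rw [angleMeasure, integral_smul_measure, intervalIntegral.integral_of_le
    (by linarith [Real.pi_pos]), ENNReal.toReal_inv, ENNReal.toReal_ofReal Real.two_pi_pos.le,
    smul_eq_mul]

/-- The distribution on the circle of the angle `u t`. -/
noncomputable def angleLaw (u : ℝ → ℝ) : Measure Circle :=
  angleMeasure.map fun t => Circle.exp (u t)

/-- The Herglotz transform of `angleLaw u`. -/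
noncomputable def herglotz (u : ℝ → ℝ) (z : ℂ) : ℂ :=
  ∫ t, ((Circle.exp (u t) : ℂ) + z) / ((Circle.exp (u t) : ℂ) - z) ∂angleMeasure

theorem measurable_exp_comp {u : ℝ → ℝ} (hu : Measurable u) :
    Measurable fun t => Circle.exp (u t) :=
  Circle.exp.continuous.measurable.comp hu

theorem measurable_coe_circle : Measurable fun ζ : Circle => (ζ : ℂ) :=
  Continuous.measurable (by fun_prop)

theorem measurable_coe_exp_comp {u : ℝ → ℝ} (hu : Measurable u) :
    Measurable fun t => (Circle.exp (u t) : ℂ) :=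
  measurable_coe_circle.comp (measurable_exp_comp hu)

theorem measurable_kernel {u : ℝ → ℝ} (hu : Measurable u) (z : ℂ) :
    Measurable fun t => ((Circle.exp (u t) : ℂ) + z) / ((Circle.exp (u t) : ℂ) - z) :=
  ((measurable_coe_exp_comp hu).add_const z).div ((measurable_coe_exp_comp hu).sub_const z)

theorem isSingularInner_herglotz {N : ℕ → ℕ} {u : ℝ → ℝ}
    (hN : Filter.Tendsto N Filter.atTop Filter.atTop) (hpos : ∀ j, 0 < N j) (hu : Measurable u)
    (h : ∀ j t, ‖Complex.exp (Complex.I * ((N j * u t : ℝ) : ℂ)) - 1‖ < 1) :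
    IsSingularInner fun z : Disk => Complex.exp (-herglotz u z) := by
  have hm := measurable_exp_comp hu
  have hprob : IsProbabilityMeasure (angleLaw u) := Measure.isProbabilityMeasure_map hm.aemeasurable
  refine ⟨angleLaw u, inferInstance, IsProbabilityMeasure.ne_zero _,
    Measure.MutuallySingular.symm ⟨nearRoots N, measurableSet_nearRoots N,
      circleLebesgue_nearRoots hN hpos, ?_⟩, ?_⟩
  · rw [angleLaw, Measure.map_apply hm (measurableSet_nearRoots N).compl]
    convert measure_empty (μ := angleMeasure)
    rw [Set.preimage_compl, Set.compl_empty_iff]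
    refine Set.eq_univ_of_forall fun t j => ?_
    rw [coe_exp_pow]
    exact h j t
  · ext z
    rw [singularInner, angleLaw, integral_map hm.aemeasurable, herglotz]
    exact ((measurable_coe_circle.add_const _).div
      (measurable_coe_circle.sub_const _)).aestronglyMeasurable

theorem norm_kernel_denom_ge {z : ℂ} (ζ : Circle) : 1 - ‖z‖ ≤ ‖(ζ : ℂ) - z‖ := by
  have := norm_sub_norm_le (ζ : ℂ) z
  rwa [Circle.norm_coe] at this

theorem norm_kernel_le {z : ℂ} (hz : ‖z‖ < 1) (ζ : Circle) :
    ‖((ζ : ℂ) + z) / ((ζ : ℂ) - z)‖ ≤ 2 / (1 - ‖z‖) := by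
  rw [norm_div]
  have h : ‖(ζ : ℂ) + z‖ ≤ 2 := by
    refine (norm_add_le _ _).trans ?_
    rw [Circle.norm_coe]
    linarith
  exact div_le_div₀ (by norm_num) h (by linarith) (norm_kernel_denom_ge ζ)

theorem integrable_kernel {u : ℝ → ℝ} (hu : Measurable u) {z : ℂ} (hz : ‖z‖ < 1) :
    Integrable (fun t => ((Circle.exp (u t) : ℂ) + z) / ((Circle.exp (u t) : ℂ) - z))
      angleMeasure :=
  Integrable.of_bound (measurable_kernel hu z).aestronglyMeasurable (2 / (1 - ‖z‖))
    (Filter.Eventually.of_forall fun _ => norm_kernel_le hz _)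

theorem differentiableOn_herglotz {u : ℝ → ℝ} (hu : Measurable u) :
    DifferentiableOn ℂ (herglotz u) (Metric.ball 0 1) := by
  intro z hz
  rw [mem_ball_zero_iff] at hz
  obtain ⟨r, hzr, hr⟩ := exists_between hz
  have hs : Metric.ball (0 : ℂ) r ∈ nhds z := Metric.isOpen_ball.mem_nhds (by simpa using hzr)
  have hlt : ∀ x ∈ Metric.ball (0 : ℂ) r, ‖x‖ < r := fun x hx => by simpa using hx
  refine (hasDerivAt_integral_of_dominated_loc_of_deriv_le (μ := angleMeasure)
    (F := fun x t => ((Circle.exp (u t) : ℂ) + x) / ((Circle.exp (u t) : ℂ) - x))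
    (F' := fun x t => 2 * (Circle.exp (u t) : ℂ) / ((Circle.exp (u t) : ℂ) - x) ^ 2)
    (bound := fun _ => 2 / (1 - r) ^ 2) hs
    (Filter.Eventually.of_forall fun x => (measurable_kernel hu x).aestronglyMeasurable)
    (integrable_kernel hu hz) ?_ ?_ (integrable_const _) ?_).2.differentiableAt
    |>.differentiableWithinAt
  · exact (((measurable_coe_exp_comp hu).const_mul 2).div
      (((measurable_coe_exp_comp hu).sub_const z).pow_const 2)).aestronglyMeasurable
  · refine Filter.Eventually.of_forall fun t x hx => ?_
    have h1 := norm_kernel_denom_ge (z := x) (Circle.exp (u t))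
    have h2 := hlt x hx
    rw [norm_div, norm_mul, norm_pow, Circle.norm_coe, mul_one, Complex.norm_ofNat]
    have h3 : 0 < 1 - r := by linarith
    gcongr
    linarith
  · refine Filter.Eventually.of_forall fun t x hx => ?_
    have h1 := norm_kernel_denom_ge (z := x) (Circle.exp (u t))
    have h2 := hlt x hx
    have h3 : (Circle.exp (u t) : ℂ) - x ≠ 0 := norm_pos_iff.1 (by linarith)
    refine (((hasDerivAt_id' x).const_add (Circle.exp (u t) : ℂ)).fun_div
      ((hasDerivAt_id' x).const_sub (Circle.exp (u t) : ℂ)) h3).congr_deriv ?_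
    ring

theorem re_kernel_nonneg {z : ℂ} (hz : ‖z‖ < 1) (ζ : Circle) :
    0 ≤ (((ζ : ℂ) + z) / ((ζ : ℂ) - z)).re := by
  have h := congrFun (poissonKernel_eq_re_herglotzRieszKernel (c := 0) (w := z)) (ζ : ℂ)
  simp only [poissonKernel_def, Function.comp_apply, herglotzRieszKernel_def, sub_zero,
    Circle.norm_coe] at h
  rw [← h]
  have : ‖z‖ ^ 2 ≤ 1 ^ 2 := pow_le_pow_left₀ (norm_nonneg _) hz.le 2
  exact div_nonneg (by linarith) (by positivity)

theorem re_herglotz {u : ℝ → ℝ} (hu : Measurable u) {z : ℂ} (hz : ‖z‖ < 1) :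
    (herglotz u z).re =
      ∫ t, (((Circle.exp (u t) : ℂ) + z) / ((Circle.exp (u t) : ℂ) - z)).re ∂angleMeasure :=
  (integral_re (integrable_kernel hu hz)).symm

theorem re_herglotz_nonneg {u : ℝ → ℝ} (hu : Measurable u) {z : ℂ} (hz : ‖z‖ < 1) :
    0 ≤ (herglotz u z).re := by
  rw [re_herglotz hu hz]
  exact integral_nonneg fun t => re_kernel_nonneg hz _

/-- The real part is the Poisson kernel, whose mean over the circle is `1`; by periodicity the shift
`s` does not matter. -/
theorem integral_re_kernel_translate {z : ℂ} (hz : ‖z‖ < 1) (s : ℝ) :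
    ∫ t, (((Circle.exp (t - s) : ℂ) + z) / ((Circle.exp (t - s) : ℂ) - z)).re ∂angleMeasure = 1 := by
  set g : ℝ → ℝ := fun t => (((Circle.exp t : ℂ) + z) / ((Circle.exp t : ℂ) - z)).re with hg
  have h1 := DiffContOnCl.circleAverage_re_herglotzRieszKernel_smul' (f := fun _ => (1 : ℂ))
    (R := 1) (c := 0) (w := z) diffContOnCl_const (by simpa using hz)
  have h2 : (2 * Real.pi)⁻¹ * ∫ t in (0 : ℝ)..2 * Real.pi, g t = 1 := by
    rw [Real.circleAverage_def] at h1
    simp only [sub_zero, Complex.real_smul, mul_one] at h1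
    rw [intervalIntegral.integral_ofReal, ← Complex.ofReal_mul, Complex.ofReal_eq_one] at h1
    rw [← h1]
    congr 2
    ext t
    simp [hg, circleMap]
  have hper : Function.Periodic g (2 * Real.pi) := fun t => by
    simp only [hg, Circle.exp_add, Circle.exp_two_pi, mul_one]
  have h3 := hper.intervalIntegral_add_eq (-Real.pi - s) 0
  rw [integral_angleMeasure, intervalIntegral.integral_comp_sub_right g s, ← h2]
  rw [zero_add] at h3
  rw [← h3]
  congr 3
  ring

/-- If `v` is a piecewise translation with at most `K` pieces, its Herglotz transform has real part
at most `K`. -/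
theorem re_herglotz_le {v : ℝ → ℝ} (hv : Measurable v) {F : Finset ℝ}
    (hF : ∀ t, ∃ s ∈ F, v t = t - s) {z : ℂ} (hz : ‖z‖ < 1) :
    (herglotz v z).re ≤ F.card := by
  rw [re_herglotz hv hz]
  have hint : ∀ s : ℝ, Integrable (fun t =>
      (((Circle.exp (t - s) : ℂ) + z) / ((Circle.exp (t - s) : ℂ) - z)).re) angleMeasure :=
    fun s => (integrable_kernel (measurable_id.sub_const s) hz).re
  -- The kernel is nonnegative, so the one shift active at `t` may be replaced by the sum over all
  -- shifts, each of which integrates to `1`.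
  calc _ ≤ ∫ t, ∑ s ∈ F, (((Circle.exp (t - s) : ℂ) + z) / ((Circle.exp (t - s) : ℂ) - z)).re
        ∂angleMeasure := by
        refine integral_mono (integrable_kernel hv hz).re
          (integrable_finsetSum _ fun s _ => hint s) fun t => ?_
        obtain ⟨s, hs, hst⟩ := hF t
        simp only [hst]
        exact Finset.single_le_sum (f := fun s =>
          (((Circle.exp (t - s) : ℂ) + z) / ((Circle.exp (t - s) : ℂ) - z)).re)
          (fun s _ => re_kernel_nonneg hz _) hs
    _ = F.card := by
        rw [integral_finsetSum _ fun s _ => hint s]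
        simp only [integral_re_kernel_translate hz, Finset.sum_const, nsmul_eq_mul, mul_one]

theorem norm_herglotz_sub_le {u v : ℝ → ℝ} (hu : Measurable u) (hv : Measurable v) {η : ℝ}
    (h : ∀ t, |u t - v t| ≤ η) {z : ℂ} (hz : ‖z‖ ≤ 1 / 2) :
    ‖herglotz v z - herglotz u z‖ ≤ 4 * η := by
  have hz1 : ‖z‖ < 1 := by linarith
  rw [herglotz, herglotz, ← integral_sub (integrable_kernel hv hz1) (integrable_kernel hu hz1)]
  refine (norm_integral_le_of_norm_le_const (C := 4 * η)
    (Filter.Eventually.of_forall fun t => ?_)).trans (by simp)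
  set a : ℂ := (Circle.exp (u t) : ℂ) with ha
  set b : ℂ := (Circle.exp (v t) : ℂ) with hb
  have ha' := norm_kernel_denom_ge (z := z) (Circle.exp (u t))
  have hb' := norm_kernel_denom_ge (z := z) (Circle.exp (v t))
  rw [← ha] at ha'
  rw [← hb] at hb'
  have ha0 : a - z ≠ 0 := norm_pos_iff.1 (by linarith)
  have hb0 : b - z ≠ 0 := norm_pos_iff.1 (by linarith)
  have hab : ‖a - b‖ ≤ η := by
    have h1 : a - b = b * (Complex.exp (Complex.I * ((u t - v t : ℝ) : ℂ)) - 1) := by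
      rw [mul_sub, ha, hb, Circle.coe_exp, Circle.coe_exp, ← Complex.exp_add]
      push_cast
      ring_nf
    rw [h1, norm_mul, hb, Circle.norm_coe, one_mul]
    exact Real.norm_exp_I_mul_ofReal_sub_one_le.trans (h t)
  have hη : 0 ≤ η := (norm_nonneg _).trans hab
  -- With `|z| ≤ 1/2` the numerator is at most `η` and both denominators are at least `1/2`, whence
  -- `4 * η`.
  have h2 : (b + z) / (b - z) - (a + z) / (a - z) = 2 * z * (a - b) / ((b - z) * (a - z)) := by
    field_simp
    ring
  rw [h2, norm_div, norm_mul, norm_mul, norm_mul, Complex.norm_ofNat, div_le_iff₀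
    (mul_pos (norm_pos_iff.2 hb0) (norm_pos_iff.2 ha0))]
  have h3 : (1 / 2 : ℝ) * (1 / 2) ≤ ‖b - z‖ * ‖a - z‖ := by gcongr <;> linarith
  calc 2 * ‖z‖ * ‖a - b‖ ≤ 2 * (1 / 2) * η := by gcongr
    _ = 4 * η * (1 / 2 * (1 / 2)) := by ring
    _ ≤ _ := by gcongr

/-! ### Coefficient estimates and conclusion -/

/-- Testing `f ∈ K_S ∩ H²_λ` against a bounded multiple `S * H` that is close to `z ^ m` on the
disk of radius `1 / 2` bounds the `m`-th coefficient of `f`. -/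
theorem norm_taylorCoeff_le_of_test {lam : ℕ → ℝ} (hpos : ∀ n, 0 < lam n) (hmono : Monotone lam)
    {S H : ℂ → ℂ} (hS : DifferentiableOn ℂ S (Metric.ball 0 1))
    (hH : DifferentiableOn ℂ H (Metric.ball 0 1)) {M ε δ B : ℝ} {L m : ℕ}
    (hHb : ∀ z ∈ Metric.ball (0 : ℂ) 1, ‖H z‖ ≤ M)
    (hSH : ∀ z ∈ Metric.ball (0 : ℂ) 1, ‖S z * H z‖ ≤ M)
    (hε : ∀ z : ℂ, ‖z‖ ≤ 1 / 2 → ‖S z * H z - z ^ m‖ ≤ ε)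
    (hm : m < L) (hδ : 0 < δ) (hL : M ^ 2 ≤ δ ^ 2 * lam L)
    {f : Disk → ℂ} (hf : f ∈ modelSpace fun z : Disk => S z)
    (hf' : f ∈ weightedHardySpace lam) (hB : ∀ n, ‖taylorCoeff f n‖ ≤ B) :
    ‖taylorCoeff f m‖ ≤ L * (B * (2 ^ L * ε)) +
      δ / 2 * ∑' n, lam n * ‖taylorCoeff f n‖ ^ 2 + δ / 2 := by
  have hSHd : DifferentiableOn ℂ (fun z => S z * H z) (Metric.ball 0 1) := hS.mul hH
  have hε0 : 0 ≤ ε := (norm_nonneg _).trans (hε 0 (by norm_num))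
  have hc : ∀ n, taylorCoeff ((fun z : Disk => S z) * fun z : Disk => H z) n =
      iteratedDeriv n (fun z => S z * H z) 0 / (n ! : ℂ) :=
    fun n => taylorCoeff_eq (F := fun z => S z * H z) (fun _ => rfl) n
  have horth := hf.2 _ ⟨fun z : Disk => H z, mem_hardySpace_of_bounded (fun _ => rfl) hH hHb, rfl⟩
  simp only [hardyInner, hc] at horth
  refine norm_le_of_inner_eq_zero hpos hmono hf'.2 (summable_sq_norm_taylor hSHd hSH) hm
    (tsum_sq_norm_taylor_le hSHd hSH) horth hB (fun n hn => ?_) hδ hL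
  refine (norm_taylor_sub_le hSHd hε n).trans ?_
  exact mul_le_mul_of_nonneg_right (pow_le_pow_right₀ (by norm_num) hn.le) hε0

/-- The coefficient estimate for `θ = exp (-herglotz u)`, with test function
`z ^ m * exp (herglotz v)`, where `v` is close to `u`. -/
theorem norm_taylorCoeff_le_of_approx {lam : ℕ → ℝ} (hpos : ∀ n, 0 < lam n) (hmono : Monotone lam)
    {u v : ℝ → ℝ} (hu : Measurable u) (hv : Measurable v) {K η δ B : ℝ} {L m : ℕ}
    (hvK : ∀ z : ℂ, ‖z‖ < 1 → (herglotz v z).re ≤ K) (huv : ∀ t, |u t - v t| ≤ η)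
    (hη : 4 * η ≤ 1) (hm : m < L) (hδ : 0 < δ) (hL : Real.exp K ^ 2 ≤ δ ^ 2 * lam L)
    {f : Disk → ℂ} (hf : f ∈ modelSpace fun z : Disk => Complex.exp (-herglotz u z))
    (hf' : f ∈ weightedHardySpace lam) (hB : ∀ n, ‖taylorCoeff f n‖ ≤ B) :
    ‖taylorCoeff f m‖ ≤ L * (B * (2 ^ L * (8 * η))) +
      δ / 2 * ∑' n, lam n * ‖taylorCoeff f n‖ ^ 2 + δ / 2 := by
  have hHb : ∀ z ∈ Metric.ball (0 : ℂ) 1,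
      ‖z ^ m * Complex.exp (herglotz v z)‖ ≤ Real.exp K := by
    intro z hz
    rw [mem_ball_zero_iff] at hz
    rw [norm_mul, norm_pow, Complex.norm_exp]
    exact (mul_le_of_le_one_left (Real.exp_pos _).le (pow_le_one₀ (norm_nonneg _) hz.le)).trans
      (Real.exp_le_exp.2 (hvK z hz))
  refine norm_taylorCoeff_le_of_test hpos hmono (S := fun z => Complex.exp (-herglotz u z))
    (H := fun z => z ^ m * Complex.exp (herglotz v z)) (differentiableOn_herglotz hu).neg.cexp
    ((differentiableOn_id.pow m).mul (differentiableOn_herglotz hv).cexp) hHb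
    (fun z hz => ?_) (fun z hz => ?_) hm hδ hL hf hf' hB
  · have hz' : ‖z‖ < 1 := by simpa using hz
    rw [norm_mul, Complex.norm_exp]
    refine (mul_le_of_le_one_left (norm_nonneg _) ?_).trans (hHb z hz)
    rw [Real.exp_le_one_iff, Complex.neg_re]
    linarith [re_herglotz_nonneg hu hz']
  · have h1 := norm_herglotz_sub_le hu hv huv hz
    have h2 : Complex.exp (-herglotz u z) * (z ^ m * Complex.exp (herglotz v z)) - z ^ m =
        z ^ m * (Complex.exp (herglotz v z - herglotz u z) - 1) := by
      rw [sub_eq_neg_add (herglotz v z), Complex.exp_add]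
      ring
    rw [h2, norm_mul, norm_pow]
    refine (mul_le_of_le_one_left (norm_nonneg _)
      (pow_le_one₀ (norm_nonneg _) (by linarith))).trans ?_
    -- `|e^w - 1| ≤ 2|w|` for `|w| ≤ 1`, with `|w| ≤ 4 * η`.
    exact (Complex.norm_exp_sub_one_le (h1.trans hη)).trans (by linarith)

theorem exists_singularInner_inter_eq {lam : ℕ → ℝ} (hpos : ∀ n, 0 < lam n)
    (hmono : Monotone lam) (hlim : Filter.Tendsto lam Filter.atTop Filter.atTop) :
    ∃ θ : Disk → ℂ, IsSingularInner θ ∧ modelSpace θ ∩ weightedHardySpace lam = {0} := by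
  -- This is the tail condition for the bound `exp (8 ^ k)` and `δ = 1 / (k + 1)`.
  have hLex : ∀ k : ℕ, ∃ L : ℕ, k < L ∧
      Real.exp (8 ^ k) ^ 2 * ((k : ℝ) + 1) ^ 2 ≤ lam L := fun k =>
    ((Filter.eventually_gt_atTop k).and (hlim.eventually_ge_atTop _)).exists
  choose L hkL hL using hLex
  have hL0 : ∀ k, (1 : ℝ) ≤ L k := fun k => by exact_mod_cast (Nat.zero_le k).trans_lt (hkL k)
  -- Chosen so that the low-coordinate error `L * B * 2 ^ L * 8ρ` equals `B / (k + 1)`.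
  set ρ : ℕ → ℝ := fun k => (((k : ℝ) + 1) * (8 * L k * 2 ^ L k))⁻¹ with hρ
  have hρ0 : ∀ k, 0 < ρ k := fun k => by
    have := hL0 k
    positivity
  obtain ⟨N, u, hN, hN0, hu, hroots, happ⟩ := exists_cantor_map hρ0
  refine ⟨fun z : Disk => Complex.exp (-herglotz u z),
    isSingularInner_herglotz hN hN0 hu hroots, ?_⟩
  refine Set.Subset.antisymm ?_ (Set.singleton_subset_iff.2
    ⟨zero_mem_modelSpace _, zero_mem_weightedHardySpace _⟩)
  rintro f ⟨hf, hf'⟩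
  refine eq_zero_of_taylorCoeff_eq_zero hf'.1 fun m => ?_
  set B := √(∑' n, ‖taylorCoeff f n‖ ^ 2) with hBdef
  have hB : ∀ n, ‖taylorCoeff f n‖ ≤ B := fun n =>
    Real.le_sqrt_of_sq_le (hf.1.2.le_tsum n fun _ _ => by positivity)
  set C := B + (∑' n, lam n * ‖taylorCoeff f n‖ ^ 2) / 2 + 1 / 2 with hC
  have key : ∀ k, m ≤ k → ‖taylorCoeff f m‖ ≤ C / ((k : ℝ) + 1) := by
    intro k hk
    obtain ⟨v, hv, huv, F, hF, hshift⟩ := happ k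
    have hk0 : (0 : ℝ) < (k : ℝ) + 1 := by positivity
    have hLk := hL0 k
    have h2L : (1 : ℝ) ≤ 2 ^ L k := one_le_pow₀ (by norm_num)
    have hη : 4 * ρ k ≤ 1 := by
      rw [hρ]
      simp only
      rw [← div_eq_mul_inv, div_le_one (by positivity)]
      have h1 : (1 : ℝ) ≤ (k : ℝ) + 1 := by linarith [Nat.cast_nonneg (α := ℝ) k]
      have h2 : (1 : ℝ) ≤ L k * 2 ^ L k := one_le_mul_of_one_le_of_one_le hLk h2L
      have h3 : (1 : ℝ) ≤ ((k : ℝ) + 1) * (L k * 2 ^ L k) := one_le_mul_of_one_le_of_one_le h1 h2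
      linarith
    have hest := norm_taylorCoeff_le_of_approx (K := 8 ^ k) (δ := ((k : ℝ) + 1)⁻¹) hpos hmono hu hv
      (fun z hz => (re_herglotz_le hv hshift hz).trans (by exact_mod_cast hF)) huv hη
      (hk.trans_lt (hkL k)) (by positivity) (by
        rw [inv_pow, ← div_eq_inv_mul, le_div_iff₀ (by positivity)]
        exact hL k) hf hf' hB
    refine hest.trans (le_of_eq ?_)
    have h1 : L k * (B * (2 ^ L k * (8 * ρ k))) = B * ((k : ℝ) + 1)⁻¹ := by
      rw [hρ]
      simp only
      have : (L k : ℝ) ≠ 0 := by linarith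
      field_simp
    rw [h1, hC]
    ring
  have hlim0 : Filter.Tendsto (fun k : ℕ => C / ((k : ℝ) + 1)) Filter.atTop (nhds 0) :=
    tendsto_const_nhds.div_atTop
      (Filter.tendsto_atTop_add_const_right _ 1 tendsto_natCast_atTop_atTop)
  have hle := ge_of_tendsto hlim0 (Filter.eventually_atTop.2 ⟨m, key⟩)
  exact norm_le_zero_iff.1 hle

end HardyDisk

theorem mainTheorem1 (lam : ℕ → ℝ) (hpos : ∀ n, 0 < lam n) (hmono : Monotone lam)
    (hlim : Filter.Tendsto lam Filter.atTop Filter.atTop) :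
    ∃ θ : HardyDisk.Disk → ℂ, HardyDisk.IsSingularInner θ ∧
      HardyDisk.modelSpace θ ∩ HardyDisk.weightedHardySpace lam = {0} :=
  HardyDisk.exists_singularInner_inter_eq hpos hmono hlim
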